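/- **Setting.** A (one-bit) tokenized MAC at security parameter $\lambda$ consists of a distribution of classical keys $k$, a map $k\mapsto\rho_k$ that generates a quantum token, a signing measurement that turns a token and a document $m\in\{0,1\}$ into a classical signature $\sigma$, and a verification $\mathsf{verify}_k(m,\sigma)\in\{0,1\}$. The *conjugate TMAC*, $\mathsf{CTMAC}$, is the following scheme. The key is $k=(a,b)$ with $a,b$ independent and uniform in $\{0,1\}^\lambda$. The token is $H^{b}|a\rangle=\bigotimes_{i=1}^{\lambda}H^{b_i}|a_i\rangle$, where $H$ is the Hadamard gate. To sign $m$, apply $H^m$ to each of the $\lambda$ qubits of the token and measure in the standard basis; the outcome is $\sigma\in\{0,1\}^\lambda$. The algorithm $\mathsf{verify}_k(m,\sigma)$ accepts if and only if $\sigma_i=a_i$ for every $i$ with $b_i=m$. **Forging game.** A challenger samples a key $k$. A computationally unbounded quantum adversary (for each $\lambda$, a finite-dimensional workspace, an initial state, and an arbitrary finite adaptive sequence of quantum operations and oracle calls) may request at most one token and may make classical queries $(m,\sigma)$ to $\mathsf{verify}_k$. At the end it submits a finite list of document–signature pairs. Let $r\in\{0,1\}$ be the number of tokens it requested. It wins if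 at least $r+1$ distinct documents occur in the list with a signature that $\mathsf{verify}_k$ accepts. **Theorem.** $\mathsf{CTMAC}$ is unconditionally unforgeable with a single token and a classical verification oracle: every computationally unbounded adversary that requests at most one token and, on every run, makes at most polynomially many (in $\lambda$) verification queries and submits at most polynomially many pairs, wins the forging game with probability negligible in $\lambda$. Quantitatively, for every $\lambda$, every $q\ge 0$ and every $w\ge 2$, an adversary that requests at most one token, makes at most $q$ verification queries and submits at most $w$ pairs wins with probability at most $$2\,\alpha^{\lambda}\binom{q+w}{2},\qquad \alpha=\cos^2\!\left(\frac{\pi}{8}\right);$$ in particular, the probability is at most $2\alpha^\lambda\binom{q+2}{2}$ for an adversary that submits at most two pairs. -/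

import Mathlib

open scoped ComplexOrder Matrix Kronecker

namespace TokenMAC

/-! ### Finite-dimensional quantum states and measurements -/

/-- A density matrix on `ℂ^ι`. -/
structure DensityMatrix (ι : Type) [Fintype ι] where
  mat : Matrix ι ι ℂ
  posSemidef : mat.PosSemidef
  trace_eq_one : mat.trace = 1

/-- A measurement (POVM) on `ℂ^ι` with outcomes in `α`; outcome `x` occurs on the state `ρ` with
probability `tr (effect x * ρ)`. -/
structure POVM (ι α : Type) [Fintype ι] [DecidableEq ι] [Fintype α] where
  effect : α → Matrix ι ι ℂ
  posSemidef : ∀ x, (effect x).PosSemidef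
  sum_eq_one : ∑ x, effect x = 1

/-! ### Tokenized message authentication codes -/

/-- A tokenized MAC at a fixed value of the security parameter.  Keys, documents and signatures are
classical; a token is a quantum state on `ℂ^Tok`; signing is a measurement of the token;
verification may be randomized. -/
structure TMAC (Key Tok Doc Sig : Type) [Fintype Tok] [DecidableEq Tok] [Fintype Sig] where
  keyGen : PMF Key
  tokenGen : Key → DensityMatrix Tok
  sign : Doc → POVM Tok Sig
  verify : Key → Doc → Sig → PMF Bool

/-! ### Adversaries with classical oracle access -/

/-- The behaviour of an interactive quantum adversary with workspace `ℂ^d`, as a finite decision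
tree.  Each branch ends by submitting a list of documents with alleged signatures.  Before that, the
adversary may, in any order and adaptively,
* perform a general quantum measurement with operators `M i` (this includes unitaries, channels,
  random coins), and go on according to the outcome;
* send one classical query to the verification oracle and go on according to the reply;
* request a token, which it receives in a fresh register, and absorb it into its workspace by a
  general quantum measurement on workspace and token together. -/
inductive Strategy (d : ℕ) (Tok Doc Sig : Type) [Fintype Tok] [DecidableEq Tok] : Type
  | submit (answers : List (Doc × Sig))
  | measure (r : ℕ) (M : Fin r → Matrix (Fin d) (Fin d) ℂ)
      (complete : ∑ i, (M i)ᴴ * M i = 1) (next : Fin r → Strategy d Tok Doc Sig)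
  | queryVerify (m : Doc) (σ : Sig) (next : Bool → Strategy d Tok Doc Sig)
  | queryToken (r : ℕ) (M : Fin r → Matrix (Fin d) (Fin d × Tok) ℂ)
      (complete : ∑ i, (M i)ᴴ * M i = 1) (next : Fin r → Strategy d Tok Doc Sig)

namespace Strategy

variable {d : ℕ} {Tok Doc Sig : Type} [Fintype Tok] [DecidableEq Tok]

/-- The largest number of token requests on a branch. -/
def tokenCalls : Strategy d Tok Doc Sig → ℕ
  | submit _ => 0
  | measure _ _ _ next => Finset.univ.sup fun i => (next i).tokenCalls
  | queryVerify _ _ next => Finset.univ.sup fun c => (next c).tokenCalls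
  | queryToken _ _ _ next => (Finset.univ.sup fun i => (next i).tokenCalls) + 1

/-- The largest number of verification queries on a branch. -/
def verifyCalls : Strategy d Tok Doc Sig → ℕ
  | submit _ => 0
  | measure _ _ _ next => Finset.univ.sup fun i => (next i).verifyCalls
  | queryVerify _ _ next => (Finset.univ.sup fun c => (next c).verifyCalls) + 1
  | queryToken _ _ _ next => Finset.univ.sup fun i => (next i).verifyCalls

/-- The largest number of document-signature pairs submitted at the end of a branch. -/
def submissions : Strategy d Tok Doc Sig → ℕ
  | submit answers => answers.length
  | measure _ _ _ next => Finset.univ.sup fun i => (next i).submissions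
  | queryVerify _ _ next => Finset.univ.sup fun c => (next c).submissions
  | queryToken _ _ _ next => Finset.univ.sup fun i => (next i).submissions

end Strategy

/-- A computationally unbounded adversary at a fixed value of the security parameter: a workspace
dimension, an initial state of the workspace, and a strategy. -/
structure Adversary (Tok Doc Sig : Type) [Fintype Tok] [DecidableEq Tok] where
  dim : ℕ
  init : DensityMatrix (Fin dim)
  strategy : Strategy dim Tok Doc Sig

/-! ### The forging game with token and verification oracles -/

section Game

variable {Key Tok Doc Sig : Type} [Fintype Tok] [DecidableEq Tok] [Fintype Sig] [DecidableEq Doc]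

/-- The challenger verifies each submitted pair; the (random) set of distinct documents with at
least one accepted signature. -/
noncomputable def TMAC.acceptedDocs (S : TMAC Key Tok Doc Sig) (k : Key) :
    List (Doc × Sig) → PMF (Finset Doc)
  | [] => PMF.pure ∅
  | (m, σ) :: L =>
      (S.verify k m σ).bind fun c =>
        (S.acceptedDocs k L).map fun D => if c then insert m D else D

/-- `S.winProb k strat r ρ` is the probability that the adversary wins under key `k`, if it still
has to run `strat`, has already received `r` tokens and its workspace is in the state `ρ`.  The
matrix `ρ` is subnormalized: its trace is the probability of the measurement outcomes obtained so
far.  The adversary wins if, having requested `r` tokens in total, it gets at least `r + 1` distinct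
documents accepted. -/
noncomputable def TMAC.winProb (S : TMAC Key Tok Doc Sig) (k : Key) {d : ℕ} :
    Strategy d Tok Doc Sig → ℕ → Matrix (Fin d) (Fin d) ℂ → ℝ
  | .submit answers, r, ρ =>
      ρ.trace.re * ((S.acceptedDocs k answers).toOuterMeasure {D | r + 1 ≤ D.card}).toReal
  | .measure _ M _ next, r, ρ =>
      ∑ i, S.winProb k (next i) r (M i * ρ * (M i)ᴴ)
  | .queryVerify m σ next, r, ρ =>
      ∑ c, (S.verify k m σ c).toReal * S.winProb k (next c) r ρ
  | .queryToken _ M _ next, r, ρ =>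
      ∑ i, S.winProb k (next i) (r + 1) (M i * (ρ ⊗ₖ (S.tokenGen k).mat) * (M i)ᴴ)

/-- The probability that the adversary `A` wins the forging game against `S`. -/
noncomputable def TMAC.forgeProb [Fintype Key] (S : TMAC Key Tok Doc Sig)
    (A : Adversary Tok Doc Sig) : ℝ :=
  ∑ k, (S.keyGen k).toReal * S.winProb k A.strategy 0 A.init.mat

end Game

/-- A function bounded by a polynomial. -/
def PolyBounded (f : ℕ → ℕ) : Prop := ∃ p : Polynomial ℕ, ∀ n, f n ≤ p.eval n

/-- A function that tends to zero faster than every inverse polynomial. -/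
def Negligible (f : ℕ → ℝ) : Prop :=
  Asymptotics.SuperpolynomialDecay Filter.atTop (fun n : ℕ => (n : ℝ)) f

/-- Unconditional unforgeability with a single token request and a classical verification oracle:
every computationally unbounded adversary that requests at most one token, makes polynomially many
verification queries and submits polynomially many documents wins with negligible probability. -/
def UnconditionallyUnforgeableOneToken {Doc : Type} [DecidableEq Doc] {Key Tok Sig : ℕ → Type}
    [∀ n, Fintype (Key n)] [∀ n, Fintype (Tok n)] [∀ n, DecidableEq (Tok n)]
    [∀ n, Fintype (Sig n)] (S : ∀ n, TMAC (Key n) (Tok n) Doc (Sig n)) : Prop :=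
  ∀ A : ∀ n, Adversary (Tok n) Doc (Sig n),
    (∀ n, (A n).strategy.tokenCalls ≤ 1) →
    PolyBounded (fun n => (A n).strategy.verifyCalls) →
    PolyBounded (fun n => (A n).strategy.submissions) →
    Negligible fun n => (S n).forgeProb (A n)

/-! ### The one-bit conjugate TMAC -/

/-- Bit strings of length `n`; they also index the computational basis of `n` qubits. -/
abbrev Bits (n : ℕ) : Type := Fin n → Bool

/-- The Hadamard gate. -/
noncomputable def hadamard : Matrix Bool Bool ℂ :=
  Matrix.of fun x y => (if x && y then -1 else 1) / (Real.sqrt 2 : ℂ)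

/-- `H ^ b` for a bit `b`. -/
noncomputable def hadPow (b : Bool) : Matrix Bool Bool ℂ := if b then hadamard else 1

/-- `H ^ b = H ^ {b₁} ⊗ ⋯ ⊗ H ^ {bₙ}` for a bit string `b`. -/
noncomputable def hadTensor {n : ℕ} (b : Bits n) : Matrix (Bits n) (Bits n) ℂ :=
  Matrix.of fun x y => ∏ i, hadPow (b i) (x i) (y i)

theorem hadPow_conjTranspose_mul (b : Bool) : (hadPow b)ᴴ * hadPow b = 1 := by
  have h : ((Real.sqrt 2 : ℝ) : ℂ) * ((Real.sqrt 2 : ℝ) : ℂ) = 2 := by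
    rw [← Complex.ofReal_mul, Real.mul_self_sqrt (by norm_num)]; norm_num
  have h0 : ((Real.sqrt 2 : ℝ) : ℂ) ≠ 0 := by
    intro h1; rw [h1] at h; norm_num at h
  cases b
  · simp [hadPow]
  · ext x y
    cases x <;> cases y <;>
      simp [hadPow, hadamard, Matrix.mul_apply, Matrix.conjTranspose_apply] <;>
      field_simp <;> (try rw [pow_two, h]) <;> norm_num

theorem hadTensor_conjTranspose_mul {n : ℕ} (b : Bits n) : (hadTensor b)ᴴ * hadTensor b = 1 := by
  ext x y
  have h : ((hadTensor b)ᴴ * hadTensor b) x y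
      = ∏ i, ((hadPow (b i))ᴴ * hadPow (b i)) (x i) (y i) := by
    simp only [Matrix.mul_apply, Matrix.conjTranspose_apply, hadTensor, Matrix.of_apply, star_prod,
      ← Finset.prod_mul_distrib]
    rw [Finset.prod_univ_sum, Fintype.piFinset_univ]
  rw [h]
  simp only [hadPow_conjTranspose_mul, Matrix.one_apply]
  by_cases hxy : x = y
  · simp [hxy]
  · obtain ⟨i, hi⟩ := Function.ne_iff.mp hxy
    rw [if_neg hxy]
    exact Finset.prod_eq_zero (Finset.mem_univ i) (if_neg hi)

/-- The basis vector `|a⟩`. -/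
def ket {n : ℕ} (a : Bits n) : Bits n → ℂ := Pi.single a 1

/-- The vector `H ^ b |a⟩`, a tensor product of the BB84 states `H ^ {bᵢ} |aᵢ⟩`. -/
noncomputable def conjugateKet {n : ℕ} (a b : Bits n) : Bits n → ℂ := hadTensor b *ᵥ ket a

/-- The pure state `H ^ b |a⟩` as a density matrix. -/
noncomputable def conjugateToken {n : ℕ} (a b : Bits n) : DensityMatrix (Bits n) where
  mat := Matrix.vecMulVec (conjugateKet a b) (star (conjugateKet a b))
  posSemidef := Matrix.posSemidef_vecMulVec_self_star _
  trace_eq_one := by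
    rw [Matrix.trace_vecMulVec, dotProduct_comm, conjugateKet, Matrix.star_mulVec,
      Matrix.dotProduct_mulVec, Matrix.vecMul_vecMul, hadTensor_conjTranspose_mul,
      Matrix.vecMul_one]
    simp [ket]

/-- The measurement that applies `H ^ m` to each qubit and then measures in the standard basis. -/
noncomputable def signPOVM (n : ℕ) (m : Bool) : POVM (Bits n) (Bits n) where
  effect σ := (hadTensor fun _ => m)ᴴ * Matrix.single σ σ 1 * (hadTensor fun _ => m)
  posSemidef σ := by
    apply Matrix.PosSemidef.conjTranspose_mul_mul_same
    have h := Matrix.posSemidef_vecMulVec_self_star (ket σ)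
    have e : Matrix.vecMulVec (ket σ) (star (ket σ)) = Matrix.single σ σ (1 : ℂ) := by
      ext x y
      simp only [Matrix.vecMulVec_apply, ket, Pi.star_apply, Pi.single_apply, Matrix.single_apply]
      by_cases hx : x = σ <;> by_cases hy : y = σ <;> simp [hx, hy, Ne.symm]
    rwa [e] at h
  sum_eq_one := by
    rw [← Finset.sum_mul, ← Finset.mul_sum]
    have e : ∑ σ : Bits n, Matrix.single σ σ (1 : ℂ) = 1 := by
      ext x y
      simp only [Matrix.sum_apply, Matrix.single_apply, Matrix.one_apply]
      by_cases hxy : x = y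
      · subst hxy; simp
      · rw [if_neg hxy]
        exact Finset.sum_eq_zero fun σ _ => if_neg fun h => hxy (h.1.symm.trans h.2)
    rw [e, mul_one, hadTensor_conjTranspose_mul]

/-- `CTMAC` at security parameter `n`.  The key `(a, b)` is a uniformly random pair of bit strings of
length `n`, the token is `H ^ b |a⟩`, and a signature `σ` of the bit `m` is accepted exactly if it
agrees with `a` at all positions `i` with `bᵢ = m`. -/
noncomputable def ctmac (n : ℕ) : TMAC (Bits n × Bits n) (Bits n) Bool (Bits n) where
  keyGen := PMF.uniformOfFintype (Bits n × Bits n)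
  tokenGen k := conjugateToken k.1 k.2
  sign m := signPOVM n m
  verify k m σ := PMF.pure (decide (∀ i, k.2 i = m → k.1 i = σ i))

end TokenMAC

/-!
The proof bounds the winning probability by inductions on the strategy tree, with potential
functions that do not increase in total when the adversary measures.

Suppose that the token has been received.  By convexity the workspace is in a pure state
`K H ^ b |a⟩`, for a matrix `K` that does not depend on the key `(a, b)`.  Fix a signature `σ` of a
document `m` and a basis string `b`.  The strings `a` under which `σ` is valid are known at the
positions with `bᵢ = m`, and for all of them the triangle inequality in the basis `H ^ m |y⟩` gives
`‖K H ^ b |a⟩‖ ≤ ∑ y, weight m σ b y * ‖K H ^ m |y⟩‖`.  The square of the right-hand side is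
`potential m σ b K`; it does not depend on the other bits of `a`.  Two facts make it work.

* By the Cauchy–Schwarz inequality, the potentials after a measurement sum to at most the potential
  before it (`sum_potential_kraus_le`).  An attempt at a signature of the other document is valid
  for only one `a`, so that each attempt gains at most one potential
  (`sum_winProb_of_accepts_le`).  This holds although the adversary, once it has a valid signature,
  may learn `b` from the oracle.
* The sum of the potentials over `b` is a quadratic form in the norms `‖K H ^ m |y⟩‖` whose matrix
  is the tensor product of the matrices `|σᵢ⟩⟨σᵢ| + |+⟩⟨+|`, of operator norm `2 cos² (π / 8)`.  So
  the sum is at most `(2 cos² (π / 8)) ^ n` times the squared Frobenius norm of `K`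
  (`sum_potential_le`).

Splitting every query into its acceptance, after which the bound above applies, and its rejection,
Pascal's rule gives the factor `(q + w).choose 2` for the phase after the token
(`sum_winProb_token_le`).  Before the token, a query is answered positively for only `3 ^ n` of the
`4 ^ n` keys, and `3 / 4 ≤ cos² (π / 8)`; the factor `2` in the final bound absorbs these guesses
(`sum_winProb_le`).
-/

open scoped ComplexOrder Matrix Kronecker

namespace TokenMAC

/-! ### Euclidean norms and pure states -/

section Norms

variable {ι κ : Type} [Fintype ι]

/-- The Euclidean norm of a vector in `ℂ^ι`. -/
noncomputable def l2 (v : ι → ℂ) : ℝ := ‖WithLp.toLp 2 v‖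

/-- The unnormalized pure state `|v⟩⟨v|`. -/
noncomputable def proj (v : ι → ℂ) : Matrix ι ι ℂ := Matrix.vecMulVec v (star v)

theorem l2_nonneg (v : ι → ℂ) : 0 ≤ l2 v := norm_nonneg _

theorem l2_sq (v : ι → ℂ) : l2 v ^ 2 = ∑ i, ‖v i‖ ^ 2 := EuclideanSpace.norm_sq_eq _

theorem l2_sq_eq_dotProduct (v : ι → ℂ) : ((l2 v ^ 2 : ℝ) : ℂ) = star v ⬝ᵥ v := by
  rw [l2_sq, dotProduct]
  push_cast
  refine Finset.sum_congr rfl fun i _ => ?_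
  rw [Pi.star_apply, Complex.star_def, Complex.conj_mul']

theorem trace_proj_re (v : ι → ℂ) : (proj v).trace.re = l2 v ^ 2 := by
  rw [proj, Matrix.trace_vecMulVec, dotProduct_comm, ← l2_sq_eq_dotProduct, Complex.ofReal_re]

theorem posSemidef_proj (v : ι → ℂ) : (proj v).PosSemidef :=
  Matrix.posSemidef_vecMulVec_self_star v

theorem mul_proj_mul_conjTranspose (M : Matrix κ ι ℂ) (v : ι → ℂ) :
    M * proj v * Mᴴ = proj (M *ᵥ v) := by
  rw [proj, proj, Matrix.mul_vecMulVec, Matrix.vecMulVec_mul, Matrix.star_mulVec]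

variable [Fintype κ]

theorem l2_sum_smul_le (c : κ → ℂ) (u : κ → ι → ℂ) :
    l2 (∑ y, c y • u y) ≤ ∑ y, ‖c y‖ * l2 (u y) := by
  have e : WithLp.toLp 2 (∑ y, c y • u y) = ∑ y, c y • WithLp.toLp 2 (u y) := by
    simp [WithLp.toLp_sum]
  rw [l2, e]
  refine (norm_sum_le _ _).trans (le_of_eq ?_)
  simp [norm_smul, l2]

/-- The squared Frobenius norm, written as a trace. -/
noncomputable def frobSq (K : Matrix ι κ ℂ) : ℝ := (K * Kᴴ).trace.re

theorem frobSq_eq_sum (K : Matrix ι κ ℂ) : frobSq K = ∑ y, l2 (fun x => K x y) ^ 2 := by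
  simp only [l2_sq, frobSq, Matrix.trace, Matrix.diag, Matrix.mul_apply,
    Matrix.conjTranspose_apply, Complex.re_sum]
  rw [Finset.sum_comm]
  refine Finset.sum_congr rfl fun y _ => Finset.sum_congr rfl fun x _ => ?_
  rw [Complex.star_def, Complex.mul_conj', ← Complex.ofReal_pow, Complex.ofReal_re]

theorem frobSq_nonneg (K : Matrix ι κ ℂ) : 0 ≤ frobSq K := by
  rw [frobSq_eq_sum]; positivity

theorem frobSq_mul_unitary [DecidableEq κ] (K : Matrix ι κ ℂ) (U : Matrix κ κ ℂ)
    (hU : Uᴴ * U = 1) : frobSq (K * U) = frobSq K := by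
  rw [frobSq, frobSq, Matrix.conjTranspose_mul, Matrix.mul_assoc, ← Matrix.mul_assoc U,
    mul_eq_one_comm.mp hU, Matrix.one_mul]

variable {r : ℕ}

theorem sum_trace_kraus [DecidableEq κ] {M : Fin r → Matrix ι κ ℂ}
    (hM : ∑ i, (M i)ᴴ * M i = 1) (ρ : Matrix κ κ ℂ) :
    ∑ i, (M i * ρ * (M i)ᴴ).trace.re = ρ.trace.re := by
  rw [← Complex.re_sum]
  congr 1
  simp_rw [fun i => Matrix.trace_mul_comm (M i * ρ) (M i)ᴴ, ← Matrix.mul_assoc]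
  rw [← Matrix.trace_sum, ← Finset.sum_mul, hM, Matrix.one_mul]

theorem sum_l2_sq_kraus [DecidableEq κ] {M : Fin r → Matrix ι κ ℂ}
    (hM : ∑ i, (M i)ᴴ * M i = 1) (v : κ → ℂ) : ∑ i, l2 (M i *ᵥ v) ^ 2 = l2 v ^ 2 := by
  simp_rw [← trace_proj_re, ← mul_proj_mul_conjTranspose]
  exact sum_trace_kraus hM _

theorem sum_frobSq_kraus {μ : Type} [Fintype μ] [DecidableEq κ] {M : Fin r → Matrix ι κ ℂ}
    (hM : ∑ i, (M i)ᴴ * M i = 1) (K : Matrix κ μ ℂ) : ∑ i, frobSq (M i * K) = frobSq K := by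
  rw [frobSq, ← sum_trace_kraus hM]
  refine Finset.sum_congr rfl fun i _ => ?_
  rw [frobSq, Matrix.conjTranspose_mul]
  simp only [Matrix.mul_assoc]

/-- A weighted sum of norms, squared, does not increase in total under a measurement.  This is the
Cauchy–Schwarz inequality over the outcomes, applied to each pair of vectors. -/
theorem sum_sq_weighted_l2_kraus_le [DecidableEq κ] {M : Fin r → Matrix ι κ ℂ}
    (hM : ∑ i, (M i)ᴴ * M i = 1) {Y : Type} [Fintype Y] (c : Y → ℝ) (hc : ∀ y, 0 ≤ c y)
    (u : Y → κ → ℂ) :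
    ∑ i, (∑ y, c y * l2 (M i *ᵥ u y)) ^ 2 ≤ (∑ y, c y * l2 (u y)) ^ 2 := by
  have cs : ∀ y z, ∑ i, l2 (M i *ᵥ u y) * l2 (M i *ᵥ u z) ≤ l2 (u y) * l2 (u z) := by
    intro y z
    refine (Real.sum_mul_le_sqrt_mul_sqrt _ _ _).trans (le_of_eq ?_)
    rw [sum_l2_sq_kraus hM, sum_l2_sq_kraus hM, Real.sqrt_sq (l2_nonneg _),
      Real.sqrt_sq (l2_nonneg _)]
  simp_rw [sq, Finset.sum_mul_sum]
  rw [Finset.sum_comm]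
  refine Finset.sum_le_sum fun y _ => ?_
  rw [Finset.sum_comm]
  refine Finset.sum_le_sum fun z _ => ?_
  calc ∑ i, c y * l2 (M i *ᵥ u y) * (c z * l2 (M i *ᵥ u z))
      = c y * c z * ∑ i, l2 (M i *ᵥ u y) * l2 (M i *ᵥ u z) := by
        rw [Finset.mul_sum]; exact Finset.sum_congr rfl fun i _ => by ring
    _ ≤ c y * c z * (l2 (u y) * l2 (u z)) :=
        mul_le_mul_of_nonneg_left (cs y z) (mul_nonneg (hc y) (hc z))
    _ = c y * l2 (u y) * (c z * l2 (u z)) := by ring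

end Norms

/-! ### Conjugate bases -/

/-- The success probability `cos² (π / 8)` of guessing one conjugate-coded bit. -/
noncomputable abbrev bbConst : ℝ := Real.cos (Real.pi / 8) ^ 2

theorem two_mul_bbConst : 2 * bbConst = 1 + √2 / 2 := by
  have h := Real.cos_sq (Real.pi / 8)
  rw [show 2 * (Real.pi / 8) = Real.pi / 4 by ring, Real.cos_pi_div_four] at h
  rw [bbConst, h]; ring

theorem three_le_four_mul_bbConst : 3 ≤ 4 * bbConst := by
  have h := two_mul_bbConst
  have h2 : (1 : ℝ) ≤ √2 := Real.one_le_sqrt.mpr (by norm_num)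
  linarith

theorem bbConst_lt_one : bbConst < 1 := by
  have h := two_mul_bbConst
  have h2 : √2 < 2 := by rw [Real.sqrt_lt' (by norm_num)]; norm_num
  linarith

/-- The absolute value of the amplitude at `y` of a BB84 state with basis bit `β`, written in the
basis `m`: the state is the basis vector `s` if `β = m`, and unbiased otherwise. -/
noncomputable def bitWeight (m s β y : Bool) : ℝ :=
  if β = m then (if y = s then 1 else 0) else 1 / √2

/-- The product of the `bitWeight`s over all positions. -/
noncomputable def weight {n : ℕ} (m : Bool) (σ b y : Bits n) : ℝ :=
  ∏ i, bitWeight m (σ i) (b i) (y i)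

theorem weight_nonneg {n : ℕ} (m : Bool) (σ b y : Bits n) : 0 ≤ weight m σ b y := by
  refine Finset.prod_nonneg fun i _ => ?_
  unfold bitWeight
  split_ifs <;> positivity

/-- The operator norm of `|s⟩⟨s| + |+⟩⟨+|` is `2 cos² (π / 8)`. -/
theorem sum_sq_bitWeight_le (m s : Bool) (x : Bool → ℝ) :
    ∑ β, (∑ y, bitWeight m s β y * x y) ^ 2 ≤ 2 * bbConst * ∑ y, x y ^ 2 := by
  rw [two_mul_bbConst]
  have h2 : √2 ^ 2 = 2 := Real.sq_sqrt (by norm_num)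
  have h0 : (1 / √2) ^ 2 = 1 / 2 := by rw [div_pow, h2]; norm_num
  have key : ∀ p q : ℝ, p ^ 2 + (1 / √2 * p + 1 / √2 * q) ^ 2
      ≤ (1 + √2 / 2) * (p ^ 2 + q ^ 2) := by
    intro p q
    have e : (1 / √2 * p + 1 / √2 * q) ^ 2 = 1 / 2 * (p + q) ^ 2 := by
      rw [← mul_add, mul_pow, h0]
    have h1 : 1 < √2 := by rw [Real.lt_sqrt (by norm_num)]; norm_num
    rw [e]
    -- modulo `√2 ^ 2 = 2`, the difference is `(√2 - 1) / 2` times a perfect square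
    have : (1 + √2 / 2) * (p ^ 2 + q ^ 2) - (p ^ 2 + 1 / 2 * (p + q) ^ 2)
        = (√2 - 1) / 2 * (p - (√2 + 1) * q) ^ 2
          + (√2 ^ 2 - 2) * (p * q - (1 + √2) / 2 * q ^ 2) := by ring
    have hpos : 0 ≤ (√2 - 1) / 2 * (p - (√2 + 1) * q) ^ 2 :=
      mul_nonneg (by linarith) (sq_nonneg _)
    rw [h2] at this
    linarith
  have k1 := key (x true) (x false)
  have k2 := key (x false) (x true)
  cases m <;> cases s <;> simp [bitWeight] at * <;> linarith

/-- Tensor power of `sum_sq_bitWeight_le`. -/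
theorem sum_sq_weight_le {n : ℕ} (m : Bool) (σ : Bits n) (g : Bits n → ℝ) :
    ∑ b, (∑ y, weight m σ b y * g y) ^ 2 ≤ (2 * bbConst) ^ n * ∑ y, g y ^ 2 := by
  induction n with
  | zero => simp [weight]
  | succ n ih =>
    have split : ∀ f : Bits (n + 1) → ℝ, ∑ y, f y = ∑ η : Bool, ∑ y : Bits n, f (Fin.cons η y) :=
      fun f => by
        rw [← (Fin.consEquiv fun _ : Fin (n + 1) => Bool).sum_comp, Fintype.sum_prod_type]
        rfl
    have hw : ∀ (β η : Bool) (b y : Bits n),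
        weight m σ (Fin.cons β b : Bits (n + 1)) (Fin.cons η y : Bits (n + 1))
          = bitWeight m (σ 0) β η * weight m (Fin.tail σ) b y := by
      intro β η b y
      simp [weight, Fin.prod_univ_succ, Fin.tail]
    calc ∑ b, (∑ y, weight m σ b y * g y) ^ 2
        = ∑ β : Bool, ∑ b : Bits n, (∑ y : Bits n, weight m (Fin.tail σ) b y *
            ∑ η : Bool, bitWeight m (σ 0) β η * g (Fin.cons η y)) ^ 2 := by
          rw [split]
          refine Finset.sum_congr rfl fun β _ => Finset.sum_congr rfl fun b _ => ?_
          rw [split, Finset.sum_comm]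
          congr 1
          refine Finset.sum_congr rfl fun y _ => ?_
          rw [Finset.mul_sum]
          refine Finset.sum_congr rfl fun η _ => ?_
          rw [hw]; ring
      _ ≤ ∑ β : Bool, (2 * bbConst) ^ n * ∑ y : Bits n,
            (∑ η : Bool, bitWeight m (σ 0) β η * g (Fin.cons η y)) ^ 2 :=
          Finset.sum_le_sum fun β _ => ih _ _
      _ = (2 * bbConst) ^ n * ∑ y : Bits n, ∑ β : Bool,
            (∑ η : Bool, bitWeight m (σ 0) β η * g (Fin.cons η y)) ^ 2 := by
          rw [← Finset.mul_sum, Finset.sum_comm]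
      _ ≤ (2 * bbConst) ^ n * ∑ y : Bits n, 2 * bbConst * ∑ η : Bool, g (Fin.cons η y) ^ 2 := by
          gcongr
          exact sum_sq_bitWeight_le m (σ 0) _
      _ = (2 * bbConst) ^ (n + 1) * ∑ y, g y ^ 2 := by
          rw [split, Finset.sum_comm (s := (Finset.univ : Finset Bool)), ← Finset.mul_sum, pow_succ]
          ring

theorem conjTranspose_hadTensor_mul_apply {n : ℕ} (b c x y : Bits n) :
    ((hadTensor b)ᴴ * hadTensor c) x y = ∏ i, ((hadPow (b i))ᴴ * hadPow (c i)) (x i) (y i) := by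
  simp only [Matrix.mul_apply, Matrix.conjTranspose_apply, hadTensor, Matrix.of_apply, star_prod,
    ← Finset.prod_mul_distrib]
  rw [Finset.prod_univ_sum, Fintype.piFinset_univ]

theorem norm_hadPow_overlap (m β y a : Bool) :
    ‖((hadPow m)ᴴ * hadPow β) y a‖ = bitWeight m a β y := by
  by_cases h : β = m
  · subst h
    rw [hadPow_conjTranspose_mul, Matrix.one_apply, bitWeight, if_pos rfl]
    split_ifs <;> simp
  · have h2 : |√2| = √2 := abs_of_nonneg (Real.sqrt_nonneg _)
    rw [bitWeight, if_neg h]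
    cases m <;> cases β <;> first | exact absurd rfl h | skip
    all_goals cases y <;> cases a <;> simp [hadPow, hadamard]

/-- The matrix whose columns are the images under `K` of the basis `H ^ m |y⟩`. -/
noncomputable def rotate {n d : ℕ} (m : Bool) (K : Matrix (Fin d) (Bits n) ℂ) :
    Matrix (Fin d) (Bits n) ℂ :=
  K * (hadTensor (fun _ => m : Bits n) : Matrix (Bits n) (Bits n) ℂ)

/-- An upper bound for `‖K H ^ b |a⟩‖ ^ 2`, valid for all keys `(a, b)` under which `σ` is a valid
signature of `m`: expand the token in the basis `m` and apply the triangle inequality.  The bound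
does not depend on the remaining bits of `a`. -/
noncomputable def potential {n d : ℕ} (m : Bool) (σ b : Bits n)
    (K : Matrix (Fin d) (Bits n) ℂ) : ℝ :=
  (∑ y, weight m σ b y * l2 fun x => rotate m K x y) ^ 2

variable {n d : ℕ}

theorem potential_nonneg (m : Bool) (σ b : Bits n) (K : Matrix (Fin d) (Bits n) ℂ) :
    0 ≤ potential m σ b K := sq_nonneg _

theorem l2_sq_mulVec_conjugateKet_le (m : Bool) (σ a b : Bits n) (h : ∀ i, b i = m → a i = σ i)
    (K : Matrix (Fin d) (Bits n) ℂ) : l2 (K *ᵥ conjugateKet a b) ^ 2 ≤ potential m σ b K := by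
  set U : Matrix (Bits n) (Bits n) ℂ := hadTensor fun _ => m with hU
  have hUU : U * Uᴴ = 1 := mul_eq_one_comm.mp (hadTensor_conjTranspose_mul _)
  have e : K *ᵥ conjugateKet a b
      = ∑ y, (Uᴴ * hadTensor b) y a • fun x => rotate m K x y := by
    have e1 : K *ᵥ conjugateKet a b = rotate m K *ᵥ fun y => (Uᴴ * hadTensor b) y a := by
      have e2 : (fun y => (Uᴴ * hadTensor b) y a) = Uᴴ *ᵥ conjugateKet a b := by
        rw [conjugateKet, Matrix.mulVec_mulVec]
        ext y
        simp [ket]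
      rw [e2, rotate, Matrix.mulVec_mulVec, Matrix.mul_assoc, hUU, Matrix.mul_one]
    rw [e1]
    ext x
    simp [Matrix.mulVec, dotProduct, mul_comm]
  rw [e, potential]
  refine pow_le_pow_left₀ (l2_nonneg _) ((l2_sum_smul_le _ _).trans (le_of_eq ?_)) 2
  refine Finset.sum_congr rfl fun y _ => ?_
  congr 1
  rw [hU, conjTranspose_hadTensor_mul_apply, norm_prod, weight]
  refine Finset.prod_congr rfl fun i _ => ?_
  rw [norm_hadPow_overlap]
  by_cases hb : b i = m
  · rw [h i hb]
  · simp [bitWeight, hb]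

theorem sum_potential_kraus_le {r : ℕ} {M : Fin r → Matrix (Fin d) (Fin d) ℂ}
    (hM : ∑ i, (M i)ᴴ * M i = 1) (m : Bool) (σ b : Bits n) (K : Matrix (Fin d) (Bits n) ℂ) :
    ∑ i, potential m σ b (M i * K) ≤ potential m σ b K := by
  have e : ∀ i y, (fun x => rotate m (M i * K) x y) = M i *ᵥ fun x => rotate m K x y := by
    intro i y
    rw [rotate, Matrix.mul_assoc]
    rfl
  simp only [potential, e]
  exact sum_sq_weighted_l2_kraus_le hM _ (weight_nonneg m σ b) _

/-- Averaged over the basis string, the potential loses the factor `cos² (π / 8)` per qubit. -/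
theorem sum_potential_le (m : Bool) (σ : Bits n) (K : Matrix (Fin d) (Bits n) ℂ) :
    ∑ b, potential m σ b K ≤ (2 * bbConst) ^ n * frobSq K := by
  refine (sum_sq_weight_le m σ _).trans (le_of_eq ?_)
  rw [← frobSq_eq_sum, rotate, frobSq_mul_unitary _ _ (hadTensor_conjTranspose_mul _)]

/-! ### The forging game against the conjugate scheme -/

/-- `σ` is a valid signature of `m` under the key `k`. -/
abbrev Accepts (k : Bits n × Bits n) (m : Bool) (σ : Bits n) : Prop :=
  ∀ i, k.2 i = m → k.1 i = σ i

/-- The set of documents with at least one valid signature in the list. -/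
def accDocs (k : Bits n × Bits n) : List (Bool × Bits n) → Finset Bool
  | [] => ∅
  | p :: L => if Accepts k p.1 p.2 then insert p.1 (accDocs k L) else accDocs k L

theorem acceptedDocs_ctmac (k : Bits n × Bits n) (L : List (Bool × Bits n)) :
    (ctmac n).acceptedDocs k L = PMF.pure (accDocs k L) := by
  induction L with
  | nil => rfl
  | cons p L ih =>
    rw [TMAC.acceptedDocs, ih]
    simp only [ctmac, PMF.pure_bind, PMF.pure_map, accDocs, Accepts, decide_eq_true_eq]

theorem winProb_submit (k : Bits n × Bits n) (L : List (Bool × Bits n)) (r : ℕ)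
    (ρ : Matrix (Fin d) (Fin d) ℂ) :
    (ctmac n).winProb k (.submit L) r ρ
      = ρ.trace.re * if r + 1 ≤ (accDocs k L).card then 1 else 0 := by
  rw [TMAC.winProb, acceptedDocs_ctmac, PMF.toOuterMeasure_pure_apply]
  simp only [Set.mem_ofPred_eq]
  split_ifs <;> simp

theorem winProb_queryVerify (k : Bits n × Bits n) (m : Bool) (σ : Bits n)
    (next : Bool → Strategy d (Bits n) Bool (Bits n)) (r : ℕ) (ρ : Matrix (Fin d) (Fin d) ℂ) :
    (ctmac n).winProb k (.queryVerify m σ next) r ρ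
      = (ctmac n).winProb k (next (decide (Accepts k m σ))) r ρ := by
  rw [TMAC.winProb, Finset.sum_eq_single (decide (Accepts k m σ))]
  · simp [ctmac, PMF.pure_apply]
  · intro c _ hc
    simp [ctmac, PMF.pure_apply, hc]
  · simp

theorem winProb_nonneg (k : Bits n × Bits n) (s : Strategy d (Bits n) Bool (Bits n)) :
    ∀ (r : ℕ) (ρ : Matrix (Fin d) (Fin d) ℂ), ρ.PosSemidef → 0 ≤ (ctmac n).winProb k s r ρ := by
  induction s with
  | submit L =>
    intro r ρ hρ
    rw [winProb_submit]
    exact mul_nonneg (Complex.le_def.mp hρ.trace_nonneg).1 (by split_ifs <;> norm_num)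
  | measure _ M _ next ih =>
    intro r ρ hρ
    rw [TMAC.winProb]
    exact Finset.sum_nonneg fun i _ => ih i _ _ (hρ.mul_mul_conjTranspose_same _)
  | queryVerify m σ next ih =>
    intro r ρ hρ
    rw [winProb_queryVerify]
    exact ih _ _ _ hρ
  | queryToken _ M _ next ih =>
    intro r ρ hρ
    rw [TMAC.winProb]
    exact Finset.sum_nonneg fun i _ => ih i _ _
      ((hρ.kronecker (DensityMatrix.posSemidef _)).mul_mul_conjTranspose_same _)

theorem winProb_le_trace (k : Bits n × Bits n) (s : Strategy d (Bits n) Bool (Bits n)) :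
    ∀ (r : ℕ) (ρ : Matrix (Fin d) (Fin d) ℂ), ρ.PosSemidef →
      (ctmac n).winProb k s r ρ ≤ ρ.trace.re := by
  induction s with
  | submit L =>
    intro r ρ hρ
    rw [winProb_submit]
    exact mul_le_of_le_one_right (Complex.le_def.mp hρ.trace_nonneg).1
      (by split_ifs <;> norm_num)
  | measure _ M hM next ih =>
    intro r ρ hρ
    rw [TMAC.winProb, ← sum_trace_kraus hM ρ]
    exact Finset.sum_le_sum fun i _ => ih i _ _ (hρ.mul_mul_conjTranspose_same _)
  | queryVerify m σ next ih =>
    intro r ρ hρ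
    rw [winProb_queryVerify]
    exact ih _ _ _ hρ
  | queryToken _ M hM next ih =>
    intro r ρ hρ
    have e : (ρ ⊗ₖ ((ctmac n).tokenGen k).mat).trace = ρ.trace := by
      rw [Matrix.trace_kronecker, DensityMatrix.trace_eq_one, mul_one]
    rw [TMAC.winProb, ← e, ← sum_trace_kraus hM]
    exact Finset.sum_le_sum fun i _ => ih i _ _
      ((hρ.kronecker (DensityMatrix.posSemidef _)).mul_mul_conjTranspose_same _)

theorem winProb_sum {ι : Type} (k : Bits n × Bits n) (s : Strategy d (Bits n) Bool (Bits n)) :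
    ∀ (r : ℕ) (t : Finset ι) (ρ : ι → Matrix (Fin d) (Fin d) ℂ),
      (ctmac n).winProb k s r (∑ l ∈ t, ρ l) = ∑ l ∈ t, (ctmac n).winProb k s r (ρ l) := by
  induction s with
  | submit L =>
    intro r t ρ
    simp only [winProb_submit, Matrix.trace_sum, Complex.re_sum, Finset.sum_mul]
  | measure _ M _ next ih =>
    intro r t ρ
    simp only [TMAC.winProb, Matrix.mul_sum, Matrix.sum_mul, ih]
    exact Finset.sum_comm
  | queryVerify m σ next ih =>
    intro r t ρ
    simp only [winProb_queryVerify, ih]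
  | queryToken _ M _ next ih =>
    intro r t ρ
    have e : ∀ τ : Matrix (Bits n) (Bits n) ℂ,
        (∑ l ∈ t, ρ l) ⊗ₖ τ = ∑ l ∈ t, (ρ l) ⊗ₖ τ := by
      intro τ
      ext x y
      simp [Matrix.sum_apply, Finset.sum_mul]
    simp only [TMAC.winProb, e, Matrix.mul_sum, Matrix.sum_mul, ih]
    exact Finset.sum_comm

/-- Splitting a query into its acceptance and its rejection; the condition that it was rejected is
dropped from the second term. -/
theorem winProb_queryVerify_le (k : Bits n × Bits n) (m : Bool) (σ : Bits n)
    (next : Bool → Strategy d (Bits n) Bool (Bits n)) (r : ℕ) {ρ : Matrix (Fin d) (Fin d) ℂ}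
    (hρ : ρ.PosSemidef) :
    (ctmac n).winProb k (.queryVerify m σ next) r ρ
      ≤ (if Accepts k m σ then (ctmac n).winProb k (next true) r ρ else 0)
        + (ctmac n).winProb k (next false) r ρ := by
  rw [winProb_queryVerify]
  by_cases h : Accepts k m σ
  · rw [decide_eq_true h, if_pos h]
    linarith [winProb_nonneg k (next false) r ρ hρ]
  · rw [decide_eq_false h, if_neg h, zero_add]

theorem one_le_card_accDocs_le (k : Bits n × Bits n) (p : Bool × Bits n)
    (L : List (Bool × Bits n)) :
    (if 1 ≤ (accDocs k (p :: L)).card then (1 : ℝ) else 0)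
      ≤ (if Accepts k p.1 p.2 then 1 else 0) + if 1 ≤ (accDocs k L).card then 1 else 0 := by
  rw [accDocs]
  split_ifs <;> simp_all

theorem two_le_card_accDocs_le (k : Bits n × Bits n) (p : Bool × Bits n)
    (L : List (Bool × Bits n)) :
    (if 2 ≤ (accDocs k (p :: L)).card then (1 : ℝ) else 0)
      ≤ (if Accepts k p.1 p.2 then if (!p.1) ∈ accDocs k L then 1 else 0 else 0)
        + if 2 ≤ (accDocs k L).card then 1 else 0 := by
  have key : ∀ (m : Bool) (D : Finset Bool), 2 ≤ (insert m D).card → (!m) ∈ D := by decide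
  by_cases h : Accepts k p.1 p.2
  · rw [accDocs, if_pos h, if_pos h]
    by_cases h2 : 2 ≤ (insert p.1 (accDocs k L)).card
    · rw [if_pos h2, if_pos (key _ _ h2)]
      split_ifs <;> norm_num
    · rw [if_neg h2]
      split_ifs <;> norm_num
  · rw [accDocs, if_neg h, if_neg h, zero_add]

theorem mem_accDocs_cons_le (k : Bits n × Bits n) (m : Bool) (p : Bool × Bits n)
    (L : List (Bool × Bits n)) :
    (if m ∈ accDocs k (p :: L) then (1 : ℝ) else 0)
      ≤ (if Accepts k m p.2 then 1 else 0) + if m ∈ accDocs k L then 1 else 0 := by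
  by_cases h : Accepts k p.1 p.2
  · rw [accDocs, if_pos h]
    by_cases hm : m = p.1
    · rw [hm, if_pos (Finset.mem_insert_self _ _), if_pos h]
      split_ifs <;> norm_num
    · simp only [Finset.mem_insert, hm, false_or, le_add_iff_nonneg_left]
      split_ifs <;> norm_num
  · rw [accDocs, if_neg h, le_add_iff_nonneg_left]
    split_ifs <;> norm_num

theorem two_le_card_imp_mem (m : Bool) (D : Finset Bool) : 2 ≤ D.card → m ∈ D := by
  revert m D; decide

/-! ### After the token has been received -/

/-- Two signatures, one for each document, determine the string `a` of the key. -/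
theorem sum_accepts_both_le (m : Bool) (σ σ' b : Bits n) (K : Matrix (Fin d) (Bits n) ℂ) :
    ∑ a : Bits n, (if Accepts (a, b) m σ then if Accepts (a, b) (!m) σ' then
      l2 (K *ᵥ conjugateKet a b) ^ 2 else 0 else 0) ≤ potential m σ b K := by
  set a₀ : Bits n := fun i => if b i = m then σ i else σ' i with ha₀
  rw [Finset.sum_eq_single a₀]
  · split_ifs with h1 h2
    · exact l2_sq_mulVec_conjugateKet_le m σ a₀ b h1 K
    · exact potential_nonneg _ _ _ _
    · exact potential_nonneg _ _ _ _
  · intro a _ hne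
    split_ifs with h1 h2
    · refine absurd (funext fun i => ?_) hne
      by_cases hb : b i = m
      · exact (h1 i hb).trans (if_pos hb).symm
      · exact (h2 i (Bool.eq_not_of_ne hb)).trans (if_neg hb).symm
    · rfl
    · rfl
  · simp

theorem sum_mem_accDocs_le (m : Bool) (σ b : Bits n) (K : Matrix (Fin d) (Bits n) ℂ)
    (L : List (Bool × Bits n)) :
    ∑ a : Bits n, (if Accepts (a, b) m σ then l2 (K *ᵥ conjugateKet a b) ^ 2 *
      (if (!m) ∈ accDocs (a, b) L then 1 else 0) else 0) ≤ L.length * potential m σ b K := by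
  induction L with
  | nil => simp [accDocs]
  | cons p L ih =>
    have h := add_le_add (sum_accepts_both_le m σ p.2 b K) ih
    rw [← Finset.sum_add_distrib] at h
    rw [List.length_cons, Nat.cast_succ, add_mul, one_mul, add_comm]
    refine le_trans (Finset.sum_le_sum fun a _ => ?_) h
    have hp := mul_le_mul_of_nonneg_left (mem_accDocs_cons_le (a, b) (!m) p L)
      (sq_nonneg (l2 (K *ᵥ conjugateKet a b)))
    by_cases h1 : Accepts (a, b) m σ
    · simp only [if_pos h1]
      refine hp.trans (le_of_eq ?_)
      rw [mul_add, mul_ite, mul_one, mul_zero]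
    · simp only [if_neg h1, add_zero, le_refl]

/-- Winning probabilities for a fixed basis string `b`, summed over the strings `a` under which
`σ` is a valid signature of `m`.  The answers to queries about `m` are then the same for all these
`a`.  Each attempt at a signature of the other document is valid for at most one of them, hence
contributes at most the potential, which does not grow under measurements. -/
theorem sum_winProb_of_accepts_le (m : Bool) (σ b : Bits n)
    (s : Strategy d (Bits n) Bool (Bits n)) :
    ∀ (q w : ℕ) (K : Matrix (Fin d) (Bits n) ℂ), s.tokenCalls = 0 → s.verifyCalls ≤ q →
      s.submissions ≤ w →
      ∑ a : Bits n, (if Accepts (a, b) m σ then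
        (ctmac n).winProb (a, b) s 1 (proj (K *ᵥ conjugateKet a b)) else 0)
        ≤ (q + w : ℕ) * potential m σ b K := by
  induction s with
  | submit L =>
    intro q w K _ _ hw
    rw [Strategy.submissions] at hw
    have hl : (L.length : ℝ) ≤ (q + w : ℕ) := by exact_mod_cast hw.trans (Nat.le_add_left _ _)
    refine le_trans (Finset.sum_le_sum fun a _ => ?_) ((sum_mem_accDocs_le m σ b K L).trans
      (mul_le_mul_of_nonneg_right hl (potential_nonneg _ _ _ _)))
    by_cases h1 : Accepts (a, b) m σ
    · simp only [if_pos h1]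
      rw [winProb_submit, trace_proj_re]
      refine mul_le_mul_of_nonneg_left ?_ (sq_nonneg _)
      have := two_le_card_imp_mem (!m) (accDocs (a, b) L)
      by_cases h2 : 2 ≤ (accDocs (a, b) L).card
      · rw [if_pos h2, if_pos (this h2)]
      · rw [if_neg h2]
        split_ifs <;> norm_num
    · simp only [if_neg h1, le_refl]
  | measure r M hM next ih =>
    intro q w K ht hq hw
    rw [Strategy.tokenCalls] at ht
    rw [Strategy.verifyCalls] at hq
    rw [Strategy.submissions] at hw
    have ht' : ∀ i, (next i).tokenCalls = 0 := fun i =>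
      Nat.le_zero.mp (ht ▸ Finset.le_sup (f := fun i => (next i).tokenCalls) (Finset.mem_univ i))
    have hq' := fun i => (Finset.sup_le_iff.mp hq) i (Finset.mem_univ i)
    have hw' := fun i => (Finset.sup_le_iff.mp hw) i (Finset.mem_univ i)
    calc _ = ∑ i, ∑ a : Bits n, (if Accepts (a, b) m σ then
        (ctmac n).winProb (a, b) (next i) 1 (proj ((M i * K) *ᵥ conjugateKet a b)) else 0) := by
          rw [Finset.sum_comm]
          refine Finset.sum_congr rfl fun a _ => ?_
          split_ifs
          · simp only [TMAC.winProb, mul_proj_mul_conjTranspose, Matrix.mulVec_mulVec]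
          · rw [Finset.sum_const_zero]
      _ ≤ ∑ i, (q + w : ℕ) * potential m σ b (M i * K) :=
          Finset.sum_le_sum fun i _ => ih i q w (M i * K) (ht' i) (hq' i) (hw' i)
      _ ≤ _ := by
          rw [← Finset.mul_sum]
          exact mul_le_mul_of_nonneg_left (sum_potential_kraus_le hM m σ b K) (Nat.cast_nonneg _)
  | queryVerify m' σ' next ih =>
    intro q w K ht hq hw
    rw [Strategy.tokenCalls] at ht
    rw [Strategy.verifyCalls] at hq
    rw [Strategy.submissions] at hw
    obtain ⟨q, rfl⟩ : ∃ q', q = q' + 1 := ⟨q - 1, by omega⟩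
    have ht' : ∀ c, (next c).tokenCalls = 0 := fun c =>
      Nat.le_zero.mp (ht ▸ Finset.le_sup (f := fun c => (next c).tokenCalls) (Finset.mem_univ c))
    have hq' := fun c => (Finset.sup_le_iff.mp (Nat.le_of_succ_le_succ hq)) c (Finset.mem_univ c)
    have hw' := fun c => (Finset.sup_le_iff.mp hw) c (Finset.mem_univ c)
    have hP := potential_nonneg m σ b K
    have hIH := fun c => ih c q w K (ht' c) (hq' c) (hw' c)
    by_cases hm : m' = m
    · subst hm
      -- the answer is determined by `b` and by the valid signature `σ`
      refine le_trans (le_of_eq (Finset.sum_congr rfl fun a _ => ?_))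
        ((hIH (decide (∀ i, b i = m' → σ i = σ' i))).trans
          (mul_le_mul_of_nonneg_right (by push_cast; linarith) hP))
      by_cases h1 : Accepts (a, b) m' σ
      · rw [if_pos h1, if_pos h1, winProb_queryVerify]
        congr 3
        refine propext (forall₂_congr fun i hi => ?_)
        rw [h1 i hi]
      · rw [if_neg h1, if_neg h1]
    · obtain rfl : m' = !m := Bool.eq_not_of_ne hm
      have h := add_le_add (sum_accepts_both_le m σ σ' b K) (hIH false)
      rw [← Finset.sum_add_distrib] at h
      refine le_trans (Finset.sum_le_sum fun a _ => ?_) (h.trans (le_of_eq ?_))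
      · have hpos := posSemidef_proj (K *ᵥ conjugateKet a b)
        by_cases h1 : Accepts (a, b) m σ
        · simp only [if_pos h1]
          refine (winProb_queryVerify_le (a, b) (!m) σ' next 1 hpos).trans
            (add_le_add_left ?_ _)
          split_ifs
          · rw [← trace_proj_re]; exact winProb_le_trace _ _ _ _ hpos
          · exact le_refl _
        · simp only [if_neg h1, add_zero, le_refl]
      · push_cast; ring
  | queryToken _ _ _ _ _ =>
    intro q w K ht
    simp [Strategy.tokenCalls] at ht

/-- `sum_winProb_of_accepts_le`, summed over the basis string. -/
theorem sum_winProb_accepts_le (m : Bool) (σ : Bits n) (s : Strategy d (Bits n) Bool (Bits n))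
    (q w : ℕ) (K : Matrix (Fin d) (Bits n) ℂ) (ht : s.tokenCalls = 0) (hq : s.verifyCalls ≤ q)
    (hw : s.submissions ≤ w) :
    ∑ k : Bits n × Bits n, (if Accepts k m σ then
      (ctmac n).winProb k s 1 (proj (K *ᵥ conjugateKet k.1 k.2)) else 0)
      ≤ (q + w : ℕ) * ((2 * bbConst) ^ n * frobSq K) := by
  rw [Fintype.sum_prod_type_right]
  refine (Finset.sum_le_sum fun b _ =>
    sum_winProb_of_accepts_le m σ b s q w K ht hq hw).trans ?_
  rw [← Finset.mul_sum]
  exact mul_le_mul_of_nonneg_left (sum_potential_le m σ K) (Nat.cast_nonneg _)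

theorem sum_two_le_card_accDocs_le (K : Matrix (Fin d) (Bits n) ℂ) (L : List (Bool × Bits n)) :
    ∑ k : Bits n × Bits n, l2 (K *ᵥ conjugateKet k.1 k.2) ^ 2 *
      (if 2 ≤ (accDocs k L).card then 1 else 0)
      ≤ (L.length.choose 2 : ℝ) * ((2 * bbConst) ^ n * frobSq K) := by
  induction L with
  | nil => simp [accDocs]
  | cons p L ih =>
    have h1 : ∑ k : Bits n × Bits n, (if Accepts k p.1 p.2 then
        l2 (K *ᵥ conjugateKet k.1 k.2) ^ 2 * (if (!p.1) ∈ accDocs k L then 1 else 0) else 0)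
        ≤ L.length * ((2 * bbConst) ^ n * frobSq K) := by
      rw [Fintype.sum_prod_type_right]
      refine (Finset.sum_le_sum fun b _ => sum_mem_accDocs_le p.1 p.2 b K L).trans ?_
      rw [← Finset.mul_sum]
      exact mul_le_mul_of_nonneg_left (sum_potential_le p.1 p.2 K) (Nat.cast_nonneg _)
    have h := add_le_add h1 ih
    rw [← Finset.sum_add_distrib] at h
    refine le_trans (Finset.sum_le_sum fun k _ => ?_) (h.trans (le_of_eq ?_))
    · refine (mul_le_mul_of_nonneg_left (two_le_card_accDocs_le k p L) (sq_nonneg _)).trans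
        (le_of_eq ?_)
      rw [mul_add]
      congr 1
      split_ifs <;> ring
    · rw [List.length_cons, Nat.choose_succ_succ', Nat.choose_one_right]
      push_cast; ring

/-- The winning probability after the token: the pair consisting of the first valid signature and
the first valid signature of the other document is one of `(q + w).choose 2` pairs of attempts. -/
theorem sum_winProb_token_le (s : Strategy d (Bits n) Bool (Bits n)) :
    ∀ (q w : ℕ) (K : Matrix (Fin d) (Bits n) ℂ), s.tokenCalls = 0 → s.verifyCalls ≤ q →
      s.submissions ≤ w →
      ∑ k : Bits n × Bits n, (ctmac n).winProb k s 1 (proj (K *ᵥ conjugateKet k.1 k.2))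
        ≤ ((q + w).choose 2 : ℝ) * ((2 * bbConst) ^ n * frobSq K) := by
  induction s with
  | submit L =>
    intro q w K _ _ hw
    rw [Strategy.submissions] at hw
    have hl : (L.length.choose 2 : ℝ) ≤ ((q + w).choose 2 : ℝ) := by
      exact_mod_cast Nat.choose_le_choose 2 (hw.trans (Nat.le_add_left _ _))
    have hF := frobSq_nonneg K
    simp only [winProb_submit, trace_proj_re]
    exact (sum_two_le_card_accDocs_le K L).trans (mul_le_mul_of_nonneg_right hl (by positivity))
  | measure r M hM next ih =>
    intro q w K ht hq hw
    rw [Strategy.tokenCalls] at ht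
    rw [Strategy.verifyCalls] at hq
    rw [Strategy.submissions] at hw
    have ht' : ∀ i, (next i).tokenCalls = 0 := fun i =>
      Nat.le_zero.mp (ht ▸ Finset.le_sup (f := fun i => (next i).tokenCalls) (Finset.mem_univ i))
    have hq' := fun i => (Finset.sup_le_iff.mp hq) i (Finset.mem_univ i)
    have hw' := fun i => (Finset.sup_le_iff.mp hw) i (Finset.mem_univ i)
    simp only [TMAC.winProb, mul_proj_mul_conjTranspose, Matrix.mulVec_mulVec]
    rw [Finset.sum_comm, ← sum_frobSq_kraus hM K, Finset.mul_sum, Finset.mul_sum]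
    exact Finset.sum_le_sum fun i _ => ih i q w (M i * K) (ht' i) (hq' i) (hw' i)
  | queryVerify m σ next ih =>
    intro q w K ht hq hw
    rw [Strategy.tokenCalls] at ht
    rw [Strategy.verifyCalls] at hq
    rw [Strategy.submissions] at hw
    obtain ⟨q, rfl⟩ : ∃ q', q = q' + 1 := ⟨q - 1, by omega⟩
    have ht' : ∀ c, (next c).tokenCalls = 0 := fun c =>
      Nat.le_zero.mp (ht ▸ Finset.le_sup (f := fun c => (next c).tokenCalls) (Finset.mem_univ c))
    have hq' := fun c => (Finset.sup_le_iff.mp (Nat.le_of_succ_le_succ hq)) c (Finset.mem_univ c)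
    have hw' := fun c => (Finset.sup_le_iff.mp hw) c (Finset.mem_univ c)
    have h := add_le_add
      (sum_winProb_accepts_le m σ (next true) q w K (ht' true) (hq' true) (hw' true))
      (ih false q w K (ht' false) (hq' false) (hw' false))
    rw [← Finset.sum_add_distrib] at h
    refine le_trans (Finset.sum_le_sum fun k _ =>
      winProb_queryVerify_le k m σ next 1 (posSemidef_proj _)) (h.trans (le_of_eq ?_))
    rw [show q + 1 + w = q + w + 1 by ring, Nat.choose_succ_succ', Nat.choose_one_right]
    push_cast; ring
  | queryToken _ _ _ _ _ =>
    intro q w K ht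
    simp [Strategy.tokenCalls] at ht

/-! ### Before the token is received -/

/-- A fixed signature is valid for `3 ^ n` of the `4 ^ n` keys. -/
theorem sum_accepts_eq (m : Bool) (σ : Bits n) :
    ∑ k : Bits n × Bits n, (if Accepts k m σ then (1 : ℝ) else 0) = 3 ^ n := by
  have e : ∀ k : Bits n × Bits n, (if Accepts k m σ then (1 : ℝ) else 0)
      = ∏ i, if k.2 i = m → k.1 i = σ i then 1 else 0 := fun k => by
    rw [Finset.prod_ite_zero]; simp [Accepts]
  have h3 : ∀ s : Bool, ∑ p : Bool × Bool, (if p.2 = m → p.1 = s then (1 : ℝ) else 0) = 3 := by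
    intro s
    simp only [Fintype.sum_prod_type, Fintype.sum_bool]
    cases m <;> cases s <;> norm_num
  simp_rw [e]
  rw [← (Equiv.arrowProdEquivProdArrow (Fin n) (fun _ => Bool) (fun _ => Bool)).sum_comp]
  have h := Finset.prod_univ_sum (fun _ : Fin n => (Finset.univ : Finset (Bool × Bool)))
    (fun i p => if p.2 = m → p.1 = σ i then (1 : ℝ) else 0)
  rw [Fintype.piFinset_univ] at h
  simp only [h3, Finset.prod_const, Finset.card_univ, Fintype.card_fin] at h
  exact h.symm

theorem three_pow_le (n : ℕ) : (3 : ℝ) ^ n ≤ (4 * bbConst) ^ n :=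
  pow_le_pow_left₀ (by norm_num) three_le_four_mul_bbConst n

theorem sum_one_le_card_accDocs_le (L : List (Bool × Bits n)) :
    ∑ k : Bits n × Bits n, (if 1 ≤ (accDocs k L).card then (1 : ℝ) else 0)
      ≤ L.length * 3 ^ n := by
  induction L with
  | nil => simp [accDocs]
  | cons p L ih =>
    refine (Finset.sum_le_sum fun k _ => one_le_card_accDocs_le k p L).trans ?_
    rw [Finset.sum_add_distrib, sum_accepts_eq, List.length_cons]
    push_cast
    linarith

/-- The Kraus operator that adjoins a workspace in the state `v` to the token. -/
noncomputable def adjoin (v : Fin d → ℂ) : Matrix (Fin d × Bits n) (Bits n) ℂ :=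
  Matrix.of fun x y => if x.2 = y then v x.1 else 0

theorem proj_adjoin_mulVec (v : Fin d → ℂ) (φ : Bits n → ℂ) :
    proj (adjoin v *ᵥ φ) = proj v ⊗ₖ proj φ := by
  have e : adjoin v *ᵥ φ = fun x => v x.1 * φ x.2 := by
    ext x
    simp [adjoin, Matrix.mulVec, dotProduct]
  ext x y
  simp only [e, proj, Matrix.vecMulVec_apply, Matrix.kroneckerMap_apply, Pi.star_apply, star_mul']
  ring

theorem frobSq_adjoin (v : Fin d → ℂ) :
    frobSq (adjoin v : Matrix (Fin d × Bits n) (Bits n) ℂ) = 2 ^ n * l2 v ^ 2 := by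
  rw [frobSq_eq_sum]
  have e : ∀ y : Bits n, l2 (fun x => (adjoin v : Matrix (Fin d × Bits n) (Bits n) ℂ) x y) ^ 2
      = l2 v ^ 2 := by
    intro y
    rw [l2_sq, l2_sq, Fintype.sum_prod_type]
    refine Finset.sum_congr rfl fun x _ => ?_
    rw [Finset.sum_eq_single y]
    · simp [adjoin]
    · intro z _ hz
      simp [adjoin, hz]
    · simp
  simp [e]

/-- The bound after a token request, for a mixed workspace. -/
theorem sum_winProb_queryToken_le {r : ℕ} {M : Fin r → Matrix (Fin d) (Fin d × Bits n) ℂ}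
    (hM : ∑ i, (M i)ᴴ * M i = 1) (next : Fin r → Strategy d (Bits n) Bool (Bits n)) (q w : ℕ)
    (ht : ∀ i, (next i).tokenCalls = 0) (hq : ∀ i, (next i).verifyCalls ≤ q)
    (hw : ∀ i, (next i).submissions ≤ w) {ρ : Matrix (Fin d) (Fin d) ℂ} (hρ : ρ.PosSemidef) :
    ∑ k : Bits n × Bits n, (ctmac n).winProb k (.queryToken r M hM next) 0 ρ
      ≤ ((q + w).choose 2 : ℝ) * ((4 * bbConst) ^ n * ρ.trace.re) := by
  obtain ⟨N, v, hv⟩ := Matrix.posSemidef_iff_eq_sum_vecMulVec.mp hρ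
  have hρv : ρ = ∑ l, proj (v l) := hv
  have hkron : ∀ τ : Matrix (Bits n) (Bits n) ℂ, ρ ⊗ₖ τ = ∑ l, proj (v l) ⊗ₖ τ := by
    intro τ
    rw [hρv]
    ext x y
    simp [Matrix.sum_apply, Finset.sum_mul]
  have hstate : ∀ i (k : Bits n × Bits n), M i * (ρ ⊗ₖ ((ctmac n).tokenGen k).mat) * (M i)ᴴ
      = ∑ l, proj ((M i * (adjoin (v l) : Matrix _ (Bits n) ℂ)) *ᵥ conjugateKet k.1 k.2) := by
    intro i k
    rw [hkron, Matrix.mul_sum, Matrix.sum_mul]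
    refine Finset.sum_congr rfl fun l _ => ?_
    rw [← Matrix.mulVec_mulVec, ← mul_proj_mul_conjTranspose, proj_adjoin_mulVec]
    rfl
  calc _ = ∑ i, ∑ l, ∑ k : Bits n × Bits n, (ctmac n).winProb k (next i) 1
        (proj ((M i * (adjoin (v l) : Matrix _ (Bits n) ℂ)) *ᵥ conjugateKet k.1 k.2)) := by
        simp only [TMAC.winProb, hstate, winProb_sum]
        rw [Finset.sum_comm]
        exact Finset.sum_congr rfl fun i _ => Finset.sum_comm
    _ ≤ ∑ i, ∑ l, ((q + w).choose 2 : ℝ) * ((2 * bbConst) ^ n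
          * frobSq (M i * (adjoin (v l) : Matrix _ (Bits n) ℂ))) :=
        Finset.sum_le_sum fun i _ => Finset.sum_le_sum fun l _ =>
          sum_winProb_token_le (next i) q w _ (ht i) (hq i) (hw i)
    _ = ((q + w).choose 2 : ℝ) * ((2 * bbConst) ^ n * ∑ l, 2 ^ n * l2 (v l) ^ 2) := by
        rw [Finset.sum_comm]
        simp only [← Finset.mul_sum, sum_frobSq_kraus hM, frobSq_adjoin]
    _ = _ := by
        rw [hρv, Matrix.trace_sum, Complex.re_sum]
        simp only [trace_proj_re]
        rw [← Finset.mul_sum, show 4 * bbConst = 2 * bbConst * 2 by ring, mul_pow _ (2 : ℝ) n]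
        ring

/-- The bound for the whole game, before normalization by the number `4 ^ n` of keys.  A correct
guess without a token costs `3 ^ n ≤ (4 cos² (π / 8)) ^ n`, which Pascal's rule leaves room for. -/
theorem sum_winProb_le (s : Strategy d (Bits n) Bool (Bits n)) {w : ℕ} (hw2 : 2 ≤ w) :
    ∀ (q : ℕ) (ρ : Matrix (Fin d) (Fin d) ℂ), ρ.PosSemidef → s.tokenCalls ≤ 1 →
      s.verifyCalls ≤ q → s.submissions ≤ w →
      ∑ k : Bits n × Bits n, (ctmac n).winProb k s 0 ρ
        ≤ 2 * ((q + w).choose 2 : ℝ) * ((4 * bbConst) ^ n * ρ.trace.re) := by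
  have htr : ∀ ρ : Matrix (Fin d) (Fin d) ℂ, ρ.PosSemidef → 0 ≤ ρ.trace.re :=
    fun ρ hρ => (Complex.le_def.mp hρ.trace_nonneg).1
  have hC : (0 : ℝ) ≤ (4 * bbConst) ^ n := (pow_nonneg (by norm_num) n).trans (three_pow_le n)
  induction s with
  | submit L =>
    intro q ρ hρ _ _ hw
    rw [Strategy.submissions] at hw
    have hl : (L.length : ℝ) ≤ 2 * ((q + w).choose 2 : ℝ) := by
      have h1 : L.length ≤ 2 * (q + w).choose 2 := by
        rw [Nat.choose_two_right, Nat.mul_div_cancel' (Nat.even_mul_pred_self _).two_dvd]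
        exact (hw.trans (Nat.le_add_left w q)).trans
          (Nat.le_mul_of_pos_right _ (by omega))
      exact_mod_cast h1
    simp only [winProb_submit]
    rw [← Finset.mul_sum, mul_comm, ← mul_assoc]
    refine mul_le_mul_of_nonneg_right ?_ (htr ρ hρ)
    exact (sum_one_le_card_accDocs_le L).trans
      (mul_le_mul hl (three_pow_le n) (by positivity) (by positivity))
  | measure r M hM next ih =>
    intro q ρ hρ ht hq hw
    rw [Strategy.tokenCalls] at ht
    rw [Strategy.verifyCalls] at hq
    rw [Strategy.submissions] at hw
    have ht' := fun i => (Finset.sup_le_iff.mp ht) i (Finset.mem_univ i)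
    have hq' := fun i => (Finset.sup_le_iff.mp hq) i (Finset.mem_univ i)
    have hw' := fun i => (Finset.sup_le_iff.mp hw) i (Finset.mem_univ i)
    simp only [TMAC.winProb]
    rw [Finset.sum_comm, ← sum_trace_kraus hM ρ, Finset.mul_sum, Finset.mul_sum]
    exact Finset.sum_le_sum fun i _ => ih i q _ (hρ.mul_mul_conjTranspose_same _) (ht' i) (hq' i)
      (hw' i)
  | queryVerify m σ next ih =>
    intro q ρ hρ ht hq hw
    rw [Strategy.tokenCalls] at ht
    rw [Strategy.verifyCalls] at hq
    rw [Strategy.submissions] at hw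
    obtain ⟨q, rfl⟩ : ∃ q', q = q' + 1 := ⟨q - 1, by omega⟩
    have ht' := fun c => (Finset.sup_le_iff.mp ht) c (Finset.mem_univ c)
    have hq' := fun c => (Finset.sup_le_iff.mp (Nat.le_of_succ_le_succ hq)) c (Finset.mem_univ c)
    have hw' := fun c => (Finset.sup_le_iff.mp hw) c (Finset.mem_univ c)
    have hIH := ih false q ρ hρ (ht' false) (hq' false) (hw' false)
    have hacc : ∑ k : Bits n × Bits n, (if Accepts k m σ then
        (ctmac n).winProb k (next true) 0 ρ else 0) ≤ (4 * bbConst) ^ n * ρ.trace.re := by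
      refine le_trans (Finset.sum_le_sum (g := fun k => (if Accepts k m σ then (1 : ℝ) else 0)
        * ρ.trace.re) fun k _ => ?_) ?_
      · split_ifs
        · rw [one_mul]; exact winProb_le_trace _ _ _ _ hρ
        · rw [zero_mul]
      · rw [← Finset.sum_mul, sum_accepts_eq]
        exact mul_le_mul_of_nonneg_right (three_pow_le n) (htr ρ hρ)
    refine (Finset.sum_le_sum fun k _ => winProb_queryVerify_le k m σ next 0 hρ).trans ?_
    rw [Finset.sum_add_distrib, show q + 1 + w = q + w + 1 by ring, Nat.choose_succ_succ',
      Nat.choose_one_right]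
    have hX : 0 ≤ (4 * bbConst) ^ n * ρ.trace.re := mul_nonneg hC (htr ρ hρ)
    have hqw : (1 : ℝ) ≤ 2 * (q + w : ℕ) := by exact_mod_cast (by omega : 1 ≤ 2 * (q + w))
    have := mul_le_mul_of_nonneg_right hqw hX
    push_cast at this hIH ⊢
    linarith
  | queryToken r M hM next _ =>
    intro q ρ hρ ht hq hw
    rw [Strategy.tokenCalls] at ht
    rw [Strategy.verifyCalls] at hq
    rw [Strategy.submissions] at hw
    have ht' := fun i => Nat.le_zero.mp
      ((Finset.sup_le_iff.mp (Nat.le_of_succ_le_succ ht)) i (Finset.mem_univ i))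
    have hq' := fun i => (Finset.sup_le_iff.mp hq) i (Finset.mem_univ i)
    have hw' := fun i => (Finset.sup_le_iff.mp hw) i (Finset.mem_univ i)
    refine (sum_winProb_queryToken_le hM next q w ht' hq' hw' hρ).trans ?_
    rw [mul_assoc]
    have := htr ρ hρ
    exact le_mul_of_one_le_left (by positivity) (by norm_num)

/-! ### Forging probability and negligibility -/

theorem forgeProb_ctmac_eq (n : ℕ) (A : Adversary (Bits n) Bool (Bits n)) :
    (ctmac n).forgeProb A
      = (1 / 4) ^ n * ∑ k, (ctmac n).winProb k A.strategy 0 A.init.mat := by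
  rw [TMAC.forgeProb, Finset.mul_sum]
  refine Finset.sum_congr rfl fun k _ => ?_
  congr 1
  rw [ctmac, PMF.uniformOfFintype_apply]
  simp only [Fintype.card_prod, Fintype.card_fun, Fintype.card_bool, Fintype.card_fin,
    ENNReal.toReal_inv, ENNReal.toReal_natCast]
  push_cast
  rw [← mul_pow, one_div, inv_pow]
  norm_num

theorem forgeProb_ctmac_nonneg (n : ℕ) (A : Adversary (Bits n) Bool (Bits n)) :
    0 ≤ (ctmac n).forgeProb A :=
  Finset.sum_nonneg fun k _ =>
    mul_nonneg ENNReal.toReal_nonneg (winProb_nonneg k _ _ _ A.init.posSemidef)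

theorem forgeProb_ctmac_le (n : ℕ) (A : Adversary (Bits n) Bool (Bits n)) (q w : ℕ)
    (ht : A.strategy.tokenCalls ≤ 1) (hq : A.strategy.verifyCalls ≤ q)
    (hw : A.strategy.submissions ≤ w) (hw2 : 2 ≤ w) :
    (ctmac n).forgeProb A ≤ 2 * bbConst ^ n * ((q + w).choose 2 : ℝ) := by
  have h := sum_winProb_le A.strategy hw2 q A.init.mat A.init.posSemidef ht hq hw
  rw [A.init.trace_eq_one, Complex.one_re, mul_one] at h
  rw [forgeProb_ctmac_eq]
  refine (mul_le_mul_of_nonneg_left h (by positivity)).trans (le_of_eq ?_)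
  have e : ((1 : ℝ) / 4) ^ n * (4 * bbConst) ^ n = bbConst ^ n := by
    rw [← mul_pow]; congr 1; ring
  rw [← e]
  ring

theorem negligible_pow {c : ℝ} (h0 : 0 ≤ c) (h1 : c < 1) : Negligible fun n => c ^ n := fun k =>
  tendsto_pow_const_mul_const_pow_of_abs_lt_one k (by rwa [abs_of_nonneg h0])

theorem unconditionallyUnforgeable_ctmac : UnconditionallyUnforgeableOneToken ctmac := by
  rintro A ht ⟨p, hp⟩ ⟨p', hp'⟩
  -- two extra submissions are allowed so that the list bound is at least `2`
  set N : Polynomial ℕ := p + (p' + 2) with hN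
  have hdecay : Negligible fun n => 2 * ((((N ^ 2).map (Nat.castRingHom ℝ)).eval (n : ℝ))
      * bbConst ^ n) :=
    ((negligible_pow (sq_nonneg _) bbConst_lt_one).polynomial_mul _).const_mul 2
  refine hdecay.trans_abs_le fun n => ?_
  rw [abs_of_nonneg (forgeProb_ctmac_nonneg n (A n))]
  refine le_trans ?_ (le_abs_self _)
  have h := forgeProb_ctmac_le n (A n) (p.eval n) (p'.eval n + 2) (ht n) (hp n)
    ((hp' n).trans (Nat.le_add_right _ 2)) (Nat.le_add_left 2 _)
  refine h.trans ?_
  have hch : ((p.eval n + (p'.eval n + 2)).choose 2 : ℝ)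
      ≤ ((N ^ 2).map (Nat.castRingHom ℝ)).eval (n : ℝ) := by
    rw [Polynomial.eval_natCast_map, hN]
    simp only [Polynomial.eval_pow, Polynomial.eval_add, Polynomial.eval_ofNat,
      Nat.coe_castRingHom]
    exact_mod_cast Nat.choose_le_pow _ 2
  have hpos : (0 : ℝ) ≤ 2 * bbConst ^ n := by positivity
  calc _ ≤ 2 * bbConst ^ n * ((N ^ 2).map (Nat.castRingHom ℝ)).eval (n : ℝ) :=
        mul_le_mul_of_nonneg_left hch hpos
    _ = _ := by ring

end TokenMAC

theorem mainTheorem3 :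
    TokenMAC.UnconditionallyUnforgeableOneToken TokenMAC.ctmac ∧
    ∀ (n : ℕ) (A : TokenMAC.Adversary (TokenMAC.Bits n) Bool (TokenMAC.Bits n)) (q w : ℕ),
      A.strategy.tokenCalls ≤ 1 → A.strategy.verifyCalls ≤ q →
      A.strategy.submissions ≤ w → 2 ≤ w →
      (TokenMAC.ctmac n).forgeProb A
        ≤ 2 * (Real.cos (Real.pi / 8) ^ 2) ^ n * ((q + w).choose 2 : ℝ) :=
  ⟨TokenMAC.unconditionallyUnforgeable_ctmac, fun n A q w ht hq hw hw2 =>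
    TokenMAC.forgeProb_ctmac_le n A q w ht hq hw hw2⟩
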